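/- **Theorem (Soundness of Amida nets).** Formulas are those of IMLL with unit, $\varphi ::= \mathbf 1\mid X\mid\varphi\otimes\varphi\mid\varphi\multimap\varphi$ ($X$ from a countably infinite set). A hypersequent $\mathcal H$ is a finite sequence of components $\Gamma\vdash\varphi$, with $\Gamma$ a finite sequence of formulas. *Derivable* means derivable by the following rules, where $\mathcal O,\mathcal O'$ are arbitrary hypersequents: - (Ax) $\varphi\vdash\varphi$; ($\mathbf 1$R) $\vdash\mathbf 1$; (Merge) from $\mathcal O$ and $\mathcal O'$ infer $\mathcal O\mid\mathcal O'$; - exchange of neighbouring formulas in the context of the last component, and of neighbouring components; - (Cut) from $\mathcal O\mid\Gamma\vdash\varphi\mid\varphi,\Delta\vdash\psi$ infer $\mathcal O\mid\Gamma,\Delta\vdash\psi$; - ($\mathbf 1$L) from $\mathcal O\mid\Gamma\vdash\varphi$ infer $\mathcal O\mid\Gamma,\mathbf 1\vdash\varphi$; - ($\otimes$R) from $\mathcal O\mid\Gamma\vdash\varphi\mid\Delta\vdash\psi$ infer $\mathcal O\mid\Gamma,\Delta\vdash\varphi\otimes\psi$; ($\otimes$L) from $\mathcal O\mid\Gamma,\varphi,\psi\vdash\theta$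 infer $\mathcal O\mid\Gamma,\varphi\otimes\psi\vdash\theta$; - ($\multimap$R) from $\mathcal O\mid\Gamma,\varphi\vdash\psi$ infer $\mathcal O\mid\Gamma\vdash\varphi\multimap\psi$; ($\multimap$L) from $\mathcal O\mid\Gamma\vdash\varphi\mid\psi,\Delta\vdash\theta$ infer $\mathcal O\mid\Gamma,\varphi\multimap\psi,\Delta\vdash\theta$; - (Sync) from $\mathcal O\mid\Gamma\vdash\varphi\mid\Delta\vdash\psi$ infer $\mathcal O\mid\Gamma\vdash\psi\mid\Delta\vdash\varphi$. *Trees.* A nonempty hypersequent is read as the formula $\bigotimes_i(\bigotimes\Gamma_i\multimap\varphi_i)$ (with $\varphi_i$ for an empty $\Gamma_i$). A formula and a polarity give a polarized formula by $\mathbf 1^+=\mathbf 1^+$, $\mathbf 1^-=\bot^-$, $X^\pm=X^\pm$, $(\varphi\multimap\psi)^+=\varphi^-⅋^+\psi^+$, $(\varphi\multimap\psi)^-=\varphi^+\otimes^-\psi^-$, $(\varphi\otimes\psi)^+=\varphi^+\otimes^+\psi^+$, $(\varphi\otimes\psi)^-=\varphi^-⅋^-\psi^-$, and this is viewed as its syntax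 tree. Into every positive node an *up-edge* leads from below (from its parent; for the root it is the conclusion edge). A $\otimes^+$-node is thus followed by the up-edges to both its children, a $⅋^+$-node by the up-edge to its right child only (its left child is its *dashed child*), and a $\otimes^-$-node by the up-edge to its left child. Down-edges lead to a $\otimes^-$-node from its right child and to a $⅋^-$-node from both children. *Essential nets.* An essential net of $\mathcal H$ consists of the tree of the positive translation of $\mathcal H$, finitely many cuts (each given by trees of $\psi^-$ and $\psi^+$ and an up-edge from the root of the former to the root of the latter), a set of directed axiom edges from positive to negative leaves, and finitely many $\bot$-branches: points that subdivide an up-edge into two, from which a further edge leads to a $\bot^-$-leaf. *Amida nets.* The Amida nets of $\mathcal H$ are obtained from its essential nets by finitely many additions of *Amida edges*: either subdivide two different up-edges (possibly pieces of one original edge), $e_0$ into $e_{0d},e_{0u}$ and $e_1$ into $e_{1d},e_{1u}$ (lower, upper), and join the two new points by an Amida edge $e_a$, paths now running $e_{0d}e_ae_{1u}$ and $e_{1d}e_ae_{0u}$; or subdivide one up-edge by two points into $e_d,e_m,e_u$ and join these points by $e_a$, paths now running $e_de_ae_u$ and $\cdots e_me_ae_me_a\cdots$. Paths follow the directed edges,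 cross every Amida edge they meet, and never use the line between a $⅋^+$-node and its dashed child. *Correctness.* An Amida net is correct if 1. every leaf $X^+$ has exactly one outgoing axiom edge and it leads to a leaf $X^-$; every leaf $X^-$ has exactly one incoming axiom edge and it comes from a leaf $X^+$; every leaf $\bot^-$ is connected to a $\bot$-branch; no axiom edge is attached to a leaf $\mathbf 1^+$; 2. there is no directed cycle (paths being continued across Amida edges as above); 3. for every $⅋^+$-node $p$, every path from the root (starting at the bottom of the conclusion edge) that reaches the dashed child of $p$ passes through $p$. Then: if a nonempty hypersequent $\mathcal H$ has a correct Amida net, $\mathcal H$ is derivable. -/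

import Mathlib

namespace Amida

/-! ### Formulas, hypersequents and derivability -/

/-- Formulas of IMLL with unit, over the countably infinite set `ℕ` of propositional variables. -/
inductive Formula : Type
  | one : Formula
  | var (X : ℕ) : Formula
  | tensor (φ ψ : Formula) : Formula
  | lolli (φ ψ : Formula) : Formula

/-- A component `Γ ⊢ φ` of a hypersequent; contexts are finite sequences. -/
structure Sequent : Type where
  ctx : List Formula
  concl : Formula

infix:50 " ⊢ₛ " => Sequent.mk

/-- A hypersequent is a finite sequence of components, read conjunctively. -/
abbrev Hypersequent : Type := List Sequent

/-- Derivability in the multiplicative part of the hypersequent calculus (terms erased). -/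
inductive Derivable : Hypersequent → Prop
  | ax (φ : Formula) : Derivable [[φ] ⊢ₛ φ]
  | merge (O O' : Hypersequent) : Derivable O → Derivable O' → Derivable (O ++ O')
  | cut (O : Hypersequent) (Γ Δ : List Formula) (φ ψ : Formula) :
      Derivable (O ++ [Γ ⊢ₛ φ, (φ :: Δ) ⊢ₛ ψ]) → Derivable (O ++ [(Γ ++ Δ) ⊢ₛ ψ])
  | internalExchange (O : Hypersequent) (Γ Δ : List Formula) (φ ψ θ : Formula) :
      Derivable (O ++ [(Γ ++ φ :: ψ :: Δ) ⊢ₛ θ]) → Derivable (O ++ [(Γ ++ ψ :: φ :: Δ) ⊢ₛ θ])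
  | externalExchange (O O' : Hypersequent) (Γ Δ : List Formula) (φ ψ : Formula) :
      Derivable (O ++ [Γ ⊢ₛ φ, Δ ⊢ₛ ψ] ++ O') → Derivable (O ++ [Δ ⊢ₛ ψ, Γ ⊢ₛ φ] ++ O')
  | oneR : Derivable [[] ⊢ₛ Formula.one]
  | oneL (O : Hypersequent) (Γ : List Formula) (φ : Formula) :
      Derivable (O ++ [Γ ⊢ₛ φ]) → Derivable (O ++ [(Γ ++ [Formula.one]) ⊢ₛ φ])
  | tensorR (O : Hypersequent) (Γ Δ : List Formula) (φ ψ : Formula) :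
      Derivable (O ++ [Γ ⊢ₛ φ, Δ ⊢ₛ ψ]) → Derivable (O ++ [(Γ ++ Δ) ⊢ₛ φ.tensor ψ])
  | tensorL (O : Hypersequent) (Γ : List Formula) (φ ψ θ : Formula) :
      Derivable (O ++ [(Γ ++ [φ, ψ]) ⊢ₛ θ]) → Derivable (O ++ [(Γ ++ [φ.tensor ψ]) ⊢ₛ θ])
  | lolliR (O : Hypersequent) (Γ : List Formula) (φ ψ : Formula) :
      Derivable (O ++ [(Γ ++ [φ]) ⊢ₛ ψ]) → Derivable (O ++ [Γ ⊢ₛ φ.lolli ψ])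
  | lolliL (O : Hypersequent) (Γ Δ : List Formula) (φ ψ θ : Formula) :
      Derivable (O ++ [Γ ⊢ₛ φ, (ψ :: Δ) ⊢ₛ θ]) →
        Derivable (O ++ [(Γ ++ φ.lolli ψ :: Δ) ⊢ₛ θ])
  | sync (O : Hypersequent) (Γ Δ : List Formula) (φ ψ : Formula) :
      Derivable (O ++ [Γ ⊢ₛ φ, Δ ⊢ₛ ψ]) → Derivable (O ++ [Γ ⊢ₛ ψ, Δ ⊢ₛ φ])

/-- The `⊗`-conjunction of a sequence of formulas (the unit if the sequence is empty). -/
def bigTensor : List Formula → Formula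
  | [] => Formula.one
  | [φ] => φ
  | φ :: ψ :: Γ => φ.tensor (bigTensor (ψ :: Γ))

/-- `Γ ⊢ φ` is read as `⨂Γ ⊸ φ`, and `⊢ φ` as `φ`. -/
def Sequent.toFormula : Sequent → Formula
  | ⟨[], φ⟩ => φ
  | ⟨γ :: Γ, φ⟩ => (bigTensor (γ :: Γ)).lolli φ

/-- The conjunctive reading of a hypersequent. -/
def Hypersequent.toFormula (H : Hypersequent) : Formula :=
  bigTensor (H.map Sequent.toFormula)

/-! ### Polarized formulas and their trees -/

inductive Polarity : Type
  | pos : Polarity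
  | neg : Polarity

/-- Polarized MLL formulas: `1⁺`, `⊥⁻`, `Xᵖ`, `A ⊗ᵖ B`, `A ⅋ᵖ B`. -/
inductive PFormula : Type
  | one : PFormula
  | bot : PFormula
  | var (p : Polarity) (X : ℕ) : PFormula
  | tensor (p : Polarity) (A B : PFormula) : PFormula
  | par (p : Polarity) (A B : PFormula) : PFormula

namespace PFormula

def polarity : PFormula → Polarity
  | one => Polarity.pos
  | bot => Polarity.neg
  | var p _ => p
  | tensor p _ _ => p
  | par p _ _ => p

def IsLeaf : PFormula → Prop
  | one => True
  | bot => True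
  | var _ _ => True
  | tensor _ _ _ => False
  | par _ _ _ => False

/-- The subformula at an address of the tree of a formula; in an address `false` stands for
the left child and `true` for the right child. -/
def subAt : PFormula → List Bool → Option PFormula
  | A, [] => some A
  | tensor _ A _, false :: a => A.subAt a
  | tensor _ _ B, true :: a => B.subAt a
  | par _ A _, false :: a => A.subAt a
  | par _ _ B, true :: a => B.subAt a
  | _, _ :: _ => none

end PFormula

/-- The translation of a polarity and an IMLL formula into a polarized MLL formula. -/
def Formula.polarize : Polarity → Formula → PFormula
  | .pos, .one => .one
  | .neg, .one => .bot
  | p, .var X => .var p X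
  | .pos, .lolli φ ψ => .par .pos (polarize .neg φ) (polarize .pos ψ)
  | .neg, .lolli φ ψ => .tensor .neg (polarize .pos φ) (polarize .neg ψ)
  | .pos, .tensor φ ψ => .tensor .pos (polarize .pos φ) (polarize .pos ψ)
  | .neg, .tensor φ ψ => .par .neg (polarize .neg φ) (polarize .neg ψ)

/-! ### Nets -/

/-- The trees a net is built on: the tree of the conclusion and, for the `i`-th cut, the trees
of the two occurrences of the cut formula. -/
inductive Place : Type
  | main : Place
  | cutPos (i : ℕ) : Place
  | cutNeg (i : ℕ) : Place

/-- A node: a tree together with an address in it. -/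
structure Node : Type where
  place : Place
  addr : List Bool

/-- The left child of a node. On a `⅋⁺`-node this is the dashed child. -/
def Node.left (n : Node) : Node := ⟨n.place, n.addr ++ [false]⟩

/-- The right child of a node. -/
def Node.right (n : Node) : Node := ⟨n.place, n.addr ++ [true]⟩

/-- Points that subdivide an up-edge: a `⊥`-branch leading to the leaf `b`, or an end point of
the Amida edge with name `c`. -/
inductive Mark : Type
  | botBranch (b : Node) : Mark
  | amida (c : ℕ) : Mark

/-- The data drawn on the tree of a hypersequent. Every positive node `n` has one up-edge that
enters it from below, from its parent, from a cut, or (for the root) from nowhere;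
`track n` lists the points on this edge from bottom to top, so that they cut it
into `(track n).length + 1` up-edges. -/
structure Net : Type where
  cuts : List Formula
  axiomEdge : Node → Node → Prop
  track : Node → List Mark

namespace Net

/-- The formula at the root of one of the trees. -/
def tree (N : Net) (H : Hypersequent) : Place → Option PFormula
  | .main => some (H.toFormula.polarize .pos)
  | .cutPos i => (N.cuts[i]?).map (Formula.polarize .pos)
  | .cutNeg i => (N.cuts[i]?).map (Formula.polarize .neg)

/-- The polarized formula labelling a node (`none` if there is no such node). -/
def label (N : Net) (H : Hypersequent) (n : Node) : Option PFormula :=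
  (N.tree H n.place).bind fun A => A.subAt n.addr

def IsPositive (N : Net) (H : Hypersequent) (n : Node) : Prop :=
  ∃ A, N.label H n = some A ∧ A.polarity = .pos

/-- Essential nets: arbitrary axiom edges from positive leaves to negative leaves and
arbitrary `⊥`-branches from up-edges to `⊥⁻`-leaves are added to the trees. -/
structure IsEssential (N : Net) (H : Hypersequent) : Prop where
  axiomEdge_leaf : ∀ x y, N.axiomEdge x y → ∃ A B,
    N.label H x = some A ∧ A.IsLeaf ∧ A.polarity = .pos ∧
    N.label H y = some B ∧ B.IsLeaf ∧ B.polarity = .neg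
  track_positive : ∀ n, N.track n ≠ [] → N.IsPositive H n
  track_bot : ∀ n, ∀ k ∈ N.track n, ∃ b, k = .botBranch b ∧ N.label H b = some .bot

open Classical in
/-- Replace the points on the up-edge entering `n`. -/
noncomputable def setTrack (N : Net) (n : Node) (t : List Mark) : Net :=
  { N with track := Function.update N.track n t }

/-- The name `c` is not used by an Amida edge of the net. -/
def Fresh (N : Net) (c : ℕ) : Prop := ∀ n, Mark.amida c ∉ N.track n

end Net

/-- Amida nets of a hypersequent. Two different up-edges may be connected by a new Amida edge
(`crossApart` if they enter different nodes, `crossAlong` if they are two different pieces of the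
edge entering one node), or one up-edge may be connected with itself (`loop`). -/
inductive IsAmidaNet (H : Hypersequent) : Net → Prop
  | essential (N : Net) : N.IsEssential H → IsAmidaNet H N
  | crossApart (N : Net) (c : ℕ) (m n : Node) (s t s' t' : List Mark) :
      IsAmidaNet H N → N.Fresh c → m ≠ n → N.IsPositive H m → N.IsPositive H n →
      N.track m = s ++ t → N.track n = s' ++ t' →
      IsAmidaNet H ((N.setTrack m (s ++ .amida c :: t)).setTrack n (s' ++ .amida c :: t'))
  | crossAlong (N : Net) (c : ℕ) (n : Node) (s t u : List Mark) :
      IsAmidaNet H N → N.Fresh c → N.IsPositive H n → t ≠ [] → N.track n = s ++ t ++ u →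
      IsAmidaNet H (N.setTrack n (s ++ .amida c :: t ++ .amida c :: u))
  | loop (N : Net) (c : ℕ) (n : Node) (s u : List Mark) :
      IsAmidaNet H N → N.Fresh c → N.IsPositive H n → N.track n = s ++ u →
      IsAmidaNet H (N.setTrack n (s ++ .amida c :: .amida c :: u))

/-! ### Paths and correctness -/

/-- What a path visits: nodes, and up-edges. `upEdge n k` is the `k`-th piece, counted from the
bottom, of the edge entering the positive node `n`. -/
inductive Vertex : Type
  | node (n : Node) : Vertex
  | upEdge (n : Node) (k : ℕ) : Vertex

namespace Net

/-- One step of a path along the solid edges. Dashed edges give no step. -/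
inductive Step (N : Net) (H : Hypersequent) : Vertex → Vertex → Prop
  | tensorPosLeft (n : Node) (A B : PFormula) : N.label H n = some (.tensor .pos A B) →
      Step N H (.node n) (.upEdge n.left 0)
  | tensorPosRight (n : Node) (A B : PFormula) : N.label H n = some (.tensor .pos A B) →
      Step N H (.node n) (.upEdge n.right 0)
  | parPos (n : Node) (A B : PFormula) : N.label H n = some (.par .pos A B) →
      Step N H (.node n) (.upEdge n.right 0)
  | tensorNegUp (n : Node) (A B : PFormula) : N.label H n = some (.tensor .neg A B) →
      Step N H (.node n) (.upEdge n.left 0)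
  | tensorNegDown (n : Node) (A B : PFormula) : N.label H n = some (.tensor .neg A B) →
      Step N H (.node n.right) (.node n)
  | parNegLeft (n : Node) (A B : PFormula) : N.label H n = some (.par .neg A B) →
      Step N H (.node n.left) (.node n)
  | parNegRight (n : Node) (A B : PFormula) : N.label H n = some (.par .neg A B) →
      Step N H (.node n.right) (.node n)
  | cut (i : ℕ) : i < N.cuts.length →
      Step N H (.node ⟨.cutNeg i, []⟩) (.upEdge ⟨.cutPos i, []⟩ 0)
  | axiomEdge (x y : Node) : N.axiomEdge x y → Step N H (.node x) (.node y)
  /-- The topmost piece of an up-edge ends in its node. -/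
  | arrive (n : Node) : N.IsPositive H n →
      Step N H (.upEdge n (N.track n).length) (.node n)
  /-- At a `⊥`-branch a path goes straight on … -/
  | botStraight (n : Node) (k : ℕ) (b : Node) : (N.track n)[k]? = some (.botBranch b) →
      Step N H (.upEdge n k) (.upEdge n (k + 1))
  /-- … or turns to the `⊥⁻`-leaf. -/
  | botTurn (n : Node) (k : ℕ) (b : Node) : (N.track n)[k]? = some (.botBranch b) →
      Step N H (.upEdge n k) (.node b)
  /-- At an end of an Amida edge a path crosses to the other end and goes on upwards there. -/
  | amida (m n : Node) (j k c : ℕ) : (m, j) ≠ (n, k) →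
      (N.track m)[j]? = some (.amida c) → (N.track n)[k]? = some (.amida c) →
      Step N H (.upEdge m j) (.upEdge n (k + 1))

/-- The start of all paths from the root: the lowest piece of the edge entering the root node of
the conclusion. -/
def root : Vertex := .upEdge ⟨.main, []⟩ 0

/-- `l` is a path from the root to `v`. -/
def IsPathFromRoot (N : Net) (H : Hypersequent) (l : List Vertex) (v : Vertex) : Prop :=
  l.head? = some root ∧ l.getLast? = some v ∧ l.IsChain (N.Step H)

/-- The three correctness conditions. -/
structure Correct (N : Net) (H : Hypersequent) : Prop where
  var_pos : ∀ x X, N.label H x = some (.var .pos X) →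
    ∃ y, N.label H y = some (.var .neg X) ∧ ∀ z, N.axiomEdge x z ↔ z = y
  var_neg : ∀ y X, N.label H y = some (.var .neg X) →
    ∃ x, N.label H x = some (.var .pos X) ∧ ∀ z, N.axiomEdge z y ↔ z = x
  bot : ∀ b, N.label H b = some .bot → ∃ n, Mark.botBranch b ∈ N.track n
  one : ∀ x, N.label H x = some .one → ∀ y, ¬ N.axiomEdge x y
  acyclic : ∀ v, ¬ Relation.TransGen (N.Step H) v v
  dashed : ∀ p A B, N.label H p = some (.par .pos A B) →
    ∀ l, N.IsPathFromRoot H l (.node p.left) → Vertex.node p ∈ l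

end Net

end Amida

namespace Amida

/-! ### Structural and derived rules -/

namespace Derivable

/-! (Sync) turns `⊢ 1 | φ ⊢ φ` into the dual pair `⊢ φ | φ ⊢ 1` (`dual_pair`), and this makes
derivability a matter of counting. Read `⊢ φ` and `φ ⊢ 1` as signed literals. The logical rules
build the literal of a compound formula from those of its variable occurrences (`literal_of_atoms`),
and cuts on `1` assemble literals into any component. If every variable occurs equally often with
either sign, the atomic literals fall into dual pairs, so the hypersequent is derivable
(`of_balanced`).

Correctness supplies the balance: axiom edges are a bijection between leaves `X⁺` and leaves `X⁻` of
the whole net (`card_leaves_eq`), and the two trees of a cut, being dual, contribute equally to both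
signs. Cancelling the cuts leaves a balanced conclusion (`Correct.balanced`). -/

theorem perm_append {H H' : Hypersequent} (h : H.Perm H') :
    ∀ O : Hypersequent, Derivable (O ++ H) → Derivable (O ++ H') := by
  induction h with
  | nil => exact fun _ d => d
  | cons x _ ih =>
    intro O d
    simpa using ih (O ++ [x]) (by simpa using d)
  | swap x y l =>
    intro O d
    obtain ⟨Γ, φ⟩ := x
    obtain ⟨Δ, ψ⟩ := y
    simpa using externalExchange O l Δ Γ ψ φ (by simpa using d)
  | trans _ _ ih₁ ih₂ => exact fun O d => ih₂ O (ih₁ O d)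

/-- Derivability is invariant under permutation of the components. -/
theorem perm {H H' : Hypersequent} (d : Derivable H) (h : H.Perm H') : Derivable H' :=
  perm_append h [] d

theorem rotate {x : Sequent} {O : Hypersequent} (d : Derivable (x :: O)) :
    Derivable (O ++ [x]) :=
  d.perm (List.perm_append_comm (l₁ := [x]))

theorem unrotate {x : Sequent} {O : Hypersequent} (d : Derivable (O ++ [x])) :
    Derivable (x :: O) :=
  d.perm (List.perm_append_comm (l₂ := [x]))

theorem rotate_two {x y : Sequent} {O : Hypersequent} (d : Derivable (x :: y :: O)) :
    Derivable (O ++ [x, y]) :=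
  d.perm (List.perm_append_comm (l₁ := [x, y]))

theorem unrotate_two {x y : Sequent} {O : Hypersequent} (d : Derivable (O ++ [x, y])) :
    Derivable (x :: y :: O) :=
  d.perm (List.perm_append_comm (l₂ := [x, y]))

/-- A unit may be added at the front of a context of at most one formula. -/
theorem one_cons {O : Hypersequent} {φ θ : Formula} {Γ : List Formula}
    (hΓ : Γ = [] ∨ Γ = [φ]) (d : Derivable ((Γ ⊢ₛ θ) :: O)) :
    Derivable (((Formula.one :: Γ) ⊢ₛ θ) :: O) := by
  have e := oneL O Γ θ d.rotate
  rcases hΓ with rfl | rfl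
  · exact unrotate e
  · exact unrotate (internalExchange O [] [] φ Formula.one θ e)

/-- `⊢ φ | Γ ⊢ 1` yields `Γ ⊢ φ`. -/
theorem join_concl {O : Hypersequent} {Γ : List Formula} {φ : Formula}
    (d : Derivable (([] ⊢ₛ φ) :: (Γ ⊢ₛ Formula.one) :: O)) : Derivable ((Γ ⊢ₛ φ) :: O) := by
  -- Weakening `⊢ φ` to `1 ⊢ φ` permits a cut against `Γ ⊢ 1`.
  have e := one_cons (φ := φ) (Or.inl rfl) d
  have f := cut O Γ [] Formula.one φ (rotate_two (e.perm (List.Perm.swap _ _ _)))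
  rw [List.append_nil] at f
  exact unrotate f

/-- `φ ⊢ 1 | Γ ⊢ 1` yields `Γ, φ ⊢ 1`. -/
theorem join_ctx {O : Hypersequent} {Γ : List Formula} {φ : Formula}
    (d : Derivable (([φ] ⊢ₛ Formula.one) :: (Γ ⊢ₛ Formula.one) :: O)) :
    Derivable (((Γ ++ [φ]) ⊢ₛ Formula.one) :: O) := by
  have e := one_cons (φ := φ) (Or.inr rfl) d
  exact unrotate (cut O Γ [φ] Formula.one _ (rotate_two (e.perm (List.Perm.swap _ _ _))))

/-- The dual pair `⊢ φ | φ ⊢ 1`. -/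
theorem dual_pair (φ : Formula) : Derivable [[] ⊢ₛ φ, [φ] ⊢ₛ Formula.one] :=
  sync [] [] [φ] Formula.one φ (merge [_] [_] oneR (ax φ))

end Derivable

/-! ### Reduction to literals -/

/-- A signed formula as a component: `⊢ φ` or `φ ⊢ 1`. -/
def literal : Polarity → Formula → Sequent
  | .pos, φ => [] ⊢ₛ φ
  | .neg, φ => [φ] ⊢ₛ Formula.one

instance : DecidableEq Polarity := fun
  | .pos, .pos => isTrue rfl
  | .neg, .neg => isTrue rfl
  | .pos, .neg => isFalse nofun
  | .neg, .pos => isFalse nofun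

/-- The signed variable occurrences in a polarized formula. -/
def PFormula.atoms : PFormula → List (Polarity × ℕ)
  | .one => []
  | .bot => []
  | .var p X => [(p, X)]
  | .tensor _ A B => A.atoms ++ B.atoms
  | .par _ A B => A.atoms ++ B.atoms

/-- The hypersequent that has one literal for each signed variable. -/
def atomic (L : List (Polarity × ℕ)) : Hypersequent :=
  L.map fun a => literal a.1 (Formula.var a.2)

theorem atomic_append (L L' : List (Polarity × ℕ)) :
    atomic (L ++ L') = atomic L ++ atomic L' :=
  List.map_append

/-- A literal may be replaced by the literals of its variable occurrences. -/
theorem Derivable.literal_of_atoms (φ : Formula) : ∀ (p : Polarity) (O : Hypersequent),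
    Derivable (atomic (φ.polarize p).atoms ++ O) → Derivable (literal p φ :: O) := by
  have two : ∀ {φ ψ : Formula},
      (∀ p O, Derivable (atomic (φ.polarize p).atoms ++ O) → Derivable (literal p φ :: O)) →
      (∀ p O, Derivable (atomic (ψ.polarize p).atoms ++ O) → Derivable (literal p ψ :: O)) →
      ∀ p q O, Derivable (atomic ((φ.polarize p).atoms ++ (ψ.polarize q).atoms) ++ O) →
        Derivable (literal p φ :: literal q ψ :: O) := by
    intro φ ψ hφ hψ p q O d
    rw [atomic_append, List.append_assoc] at d
    exact (hψ q _ ((hφ p _ d).perm List.perm_middle.symm)).perm (.swap _ _ _)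
  induction φ with
  | one =>
    rintro (_ | _) O d
    · exact merge [_] _ oneR d
    · exact merge [_] _ (ax _) d
  | var X => rintro (_ | _) O d <;> exact d
  | tensor φ ψ ihφ ihψ =>
    rintro (_ | _) O d
    · exact unrotate (tensorR O [] [] φ ψ (two ihφ ihψ .pos .pos O d).rotate_two)
    -- `join_ctx` appends the formula of the first component, so the swap yields the order `φ, ψ`.
    · have e := join_ctx ((two ihφ ihψ .neg .neg O d).perm (.swap _ _ _))
      exact unrotate (tensorL O [] φ ψ _ e.rotate)
  | lolli φ ψ ihφ ihψ =>
    rintro (_ | _) O d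
    · have e := join_concl ((two ihφ ihψ .neg .pos O d).perm (.swap _ _ _))
      exact unrotate (lolliR O [] φ ψ e.rotate)
    · exact unrotate (lolliL O [] [] φ ψ _ (two ihφ ihψ .pos .neg O d).rotate_two)

/-- `join_ctx` adds one formula at a time at the right end; `Δ` is the context accumulated so far.
-/
theorem Derivable.ctx_of_atoms {O : Hypersequent} (Γ : List Formula) : ∀ Δ : List Formula,
    Derivable ((Δ ⊢ₛ Formula.one) ::
      (atomic (Γ.flatMap fun φ => (φ.polarize .neg).atoms) ++ O)) →
    Derivable (((Δ ++ Γ) ⊢ₛ Formula.one) :: O) := by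
  induction Γ with
  | nil => exact fun Δ d => by rwa [List.append_nil]
  | cons φ Γ ih =>
    intro Δ d
    rw [List.flatMap_cons, atomic_append, List.append_assoc] at d
    have e := join_ctx (literal_of_atoms φ .neg _ (d.perm List.perm_middle.symm))
    have f := ih _ e
    rwa [List.append_assoc] at f

theorem atoms_polarize_bigTensor (p : Polarity) : ∀ Γ : List Formula,
    ((bigTensor Γ).polarize p).atoms = Γ.flatMap fun φ => (φ.polarize p).atoms
  | [] => by cases p <;> rfl
  | [φ] => by simp [bigTensor]
  | φ :: ψ :: Γ => by
    have ih := atoms_polarize_bigTensor p (ψ :: Γ)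
    rw [List.flatMap_cons, ← ih]
    cases p <;> rfl

/-- The signed variable occurrences in a component. -/
def Sequent.atoms (s : Sequent) : List (Polarity × ℕ) :=
  (s.toFormula.polarize .pos).atoms

theorem Sequent.atoms_eq (s : Sequent) :
    s.atoms = (s.ctx.flatMap fun φ => (φ.polarize .neg).atoms) ++ (s.concl.polarize .pos).atoms := by
  obtain ⟨_ | ⟨γ, Γ⟩, φ⟩ := s
  · rfl
  · rw [← atoms_polarize_bigTensor]; rfl

/-- Next to `⊢ 1`, a component may be replaced by the literals of its variable occurrences. -/
theorem Derivable.sequent_of_one_atoms (s : Sequent) (O : Hypersequent)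
    (d : Derivable (([] ⊢ₛ Formula.one) :: (atomic s.atoms ++ O))) : Derivable (s :: O) := by
  obtain ⟨Γ, φ⟩ := s
  rw [Sequent.atoms_eq, atomic_append, List.append_assoc] at d
  have e := ctx_of_atoms Γ [] d
  exact join_concl (literal_of_atoms φ .pos _ (e.perm List.perm_middle.symm))

theorem Derivable.append_of_atoms (H : Hypersequent) : ∀ O : Hypersequent,
    Derivable (atomic (H.flatMap Sequent.atoms) ++ O) → Derivable (H ++ O) := by
  induction H with
  | nil => exact fun _ d => d
  | cons s H ih =>
    intro O d
    -- The auxiliary `⊢ 1` consumed by each component is merged in afresh.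
    refine sequent_of_one_atoms s _ (merge [_] _ oneR ?_)
    rw [List.flatMap_cons, atomic_append, List.append_assoc] at d
    refine (ih (O ++ atomic s.atoms) ?_).perm ?_
    · rw [← List.append_assoc]
      exact d.perm List.perm_append_comm
    · rw [← List.append_assoc]
      exact List.perm_append_comm

/-! ### Cancelling dual literals -/

/-- Every variable occurs equally often with either sign. -/
def Balanced (L : List (Polarity × ℕ)) : Prop :=
  ∀ X, L.count (.pos, X) = L.count (.neg, X)

/-- The head tips the count for `X` by one, so its dual must occur in the tail, and erasing that
occurrence restores the balance. -/
theorem exists_perm_dual {p q : Polarity} (hpq : p ≠ q) {X : ℕ} {L : List (Polarity × ℕ)}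
    (hL : Balanced ((p, X) :: L)) : ∃ L', L.Perm ((q, X) :: L') ∧ Balanced L' := by
  have hcons : L.count (p, X) + 1 = L.count (q, X) := by
    have h := hL X
    cases p <;> cases q <;> first | exact absurd rfl hpq | (simp at h; omega)
  have hne : ∀ Y, Y ≠ X → L.count (.pos, Y) = L.count (.neg, Y) := by
    intro Y hY
    have h := hL Y
    rwa [List.count_cons_of_ne, List.count_cons_of_ne] at h <;>
      exact fun h => hY (Prod.mk.inj h).2.symm
  have hmem : (q, X) ∈ L := List.count_pos_iff.1 (by omega)
  refine ⟨L.erase (q, X), List.perm_cons_erase hmem, fun Y => ?_⟩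
  by_cases hY : Y = X
  · subst hY
    have hp : (L.erase (q, Y)).count (p, Y) = L.count (p, Y) :=
      List.count_erase_of_ne fun h => hpq (Prod.mk.inj h).1
    have hq : (L.erase (q, Y)).count (q, Y) = L.count (q, Y) - 1 := List.count_erase_self
    cases p <;> cases q <;> first | exact absurd rfl hpq | omega
  · rw [List.count_erase_of_ne fun h => hY (Prod.mk.inj h).2,
      List.count_erase_of_ne fun h => hY (Prod.mk.inj h).2, hne Y hY]

/-- Dual pairs are split off and merged one by one. The extra `⊢ 1` serves the case of no atoms,
since the empty hypersequent is not derivable. -/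
theorem Derivable.atomic_of_balanced (L : List (Polarity × ℕ)) (hL : Balanced L) :
    Derivable (([] ⊢ₛ Formula.one) :: atomic L) := by
  induction hn : L.length using Nat.strong_induction_on generalizing L with
  | _ n ih =>
  subst hn
  rcases L with _ | ⟨⟨p, X⟩, L⟩
  · exact oneR
  have pair : ∀ q, p ≠ q →
      Derivable [literal p (Formula.var X), literal q (Formula.var X)] := by
    intro q hq
    cases p <;> cases q <;> first | exact absurd rfl hq | skip
    · exact dual_pair _
    · exact (dual_pair _).perm (.swap _ _ _)
  obtain ⟨q, hq⟩ : ∃ q, p ≠ q := by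
    cases p
    · exact ⟨.neg, nofun⟩
    · exact ⟨.pos, nofun⟩
  obtain ⟨L', hperm, hL'⟩ := exists_perm_dual hq hL
  have d := ih L'.length (by simp [hperm.length_eq]) L' hL' rfl
  refine (merge _ _ (pair q hq) d).perm ?_
  have hp : (atomic ((q, X) :: L')).Perm (atomic L) := (hperm.map _).symm
  exact List.perm_middle.trans ((hp.cons _).cons _)

/-- Derivability is complete for hypersequents whose variable occurrences are balanced. -/
theorem Derivable.of_balanced {H : Hypersequent} (hH : H ≠ [])
    (hb : Balanced (H.toFormula.polarize .pos).atoms) : Derivable H := by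
  rw [Hypersequent.toFormula, atoms_polarize_bigTensor, List.flatMap_map] at hb
  have d := atomic_of_balanced _ hb
  obtain ⟨s, H, rfl⟩ := List.exists_cons_of_ne_nil hH
  -- The `⊢ 1` from `atomic_of_balanced` is kept for the first component `s`, which uses it up.
  have e : Derivable (atomic (H.flatMap Sequent.atoms) ++
      (([] ⊢ₛ Formula.one) :: atomic s.atoms)) := by
    refine d.perm (List.Perm.trans (.cons _ ?_) List.perm_middle.symm)
    rw [List.flatMap_cons, atomic_append]
    exact List.perm_append_comm
  refine sequent_of_one_atoms s H ((append_of_atoms H _ e).perm ?_)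
  exact List.perm_middle.trans (.cons _ List.perm_append_comm)

/-! ### Counting the leaves of a net -/

/-- Reversing the polarity of a formula flips the sign of every variable occurrence; this is what
makes the cuts cancel. -/
theorem Formula.count_atoms_polarize (φ : Formula) (X : ℕ) :
    (φ.polarize .pos).atoms.count (.pos, X) = (φ.polarize .neg).atoms.count (.neg, X) ∧
    (φ.polarize .pos).atoms.count (.neg, X) = (φ.polarize .neg).atoms.count (.pos, X) := by
  induction φ with
  | one => exact ⟨rfl, rfl⟩
  | var Y => simp [Formula.polarize, PFormula.atoms, List.count_cons]
  | tensor φ ψ ihφ ihψ => simp [Formula.polarize, PFormula.atoms, ihφ, ihψ]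
  | lolli φ ψ ihφ ihψ => simp [Formula.polarize, PFormula.atoms, ihφ, ihψ]

/-- The addresses of the leaves labelled with a given signed variable. -/
abbrev PFormula.Leaves (A : PFormula) (p : Polarity) (X : ℕ) : Type :=
  {a : List Bool // A.subAt a = some (.var p X)}

/-- Leaves of a binary node are leaves of one of the children. -/
def leavesEquivSum {A B C : PFormula} {p : Polarity} {X : ℕ} (h₀ : C.subAt [] ≠ some (.var p X))
    (h₁ : ∀ a, C.subAt (false :: a) = A.subAt a) (h₂ : ∀ a, C.subAt (true :: a) = B.subAt a) :
    C.Leaves p X ≃ A.Leaves p X ⊕ B.Leaves p X where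
  toFun
    | ⟨[], h⟩ => absurd h h₀
    | ⟨false :: a, h⟩ => .inl ⟨a, h₁ a ▸ h⟩
    | ⟨true :: a, h⟩ => .inr ⟨a, h₂ a ▸ h⟩
  invFun
    | .inl a => ⟨false :: a.1, (h₁ a.1).trans a.2⟩
    | .inr a => ⟨true :: a.1, (h₂ a.1).trans a.2⟩
  left_inv
    | ⟨[], h⟩ => absurd h h₀
    | ⟨false :: _, _⟩ => rfl
    | ⟨true :: _, _⟩ => rfl
  right_inv
    | .inl _ => rfl
    | .inr _ => rfl

/-- Finiteness is proved along with the count because `Nat.card` is additive on sums only for finite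
types. -/
theorem PFormula.finite_leaves_and_card (A : PFormula) (p : Polarity) (X : ℕ) :
    Finite (A.Leaves p X) ∧ Nat.card (A.Leaves p X) = A.atoms.count (p, X) := by
  have sum : ∀ {A B C : PFormula}, C.Leaves p X ≃ A.Leaves p X ⊕ B.Leaves p X →
      C.atoms = A.atoms ++ B.atoms →
      (Finite (A.Leaves p X) ∧ Nat.card (A.Leaves p X) = A.atoms.count (p, X)) →
      (Finite (B.Leaves p X) ∧ Nat.card (B.Leaves p X) = B.atoms.count (p, X)) →
      Finite (C.Leaves p X) ∧ Nat.card (C.Leaves p X) = C.atoms.count (p, X) := by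
    rintro A B C e hC ⟨_, hA⟩ ⟨_, hB⟩
    exact ⟨Finite.of_equiv _ e.symm, by
      rw [Nat.card_congr e, Nat.card_sum, hA, hB, hC, List.count_append]⟩
  have empty : ∀ {A : PFormula}, (∀ a, A.subAt a ≠ some (.var p X)) →
      Finite (A.Leaves p X) ∧ Nat.card (A.Leaves p X) = 0 := by
    intro A hA
    have : IsEmpty (A.Leaves p X) := ⟨fun a => hA a.1 a.2⟩
    exact ⟨inferInstance, Nat.card_of_isEmpty⟩
  induction A with
  | one => exact empty fun a => by cases a <;> simp [subAt]
  | bot => exact empty fun a => by cases a <;> simp [subAt]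
  | var q Y =>
    by_cases h : (q, Y) = (p, X)
    · obtain ⟨rfl, rfl⟩ := Prod.mk.inj h
      have : Unique ((var q Y).Leaves q Y) :=
        { default := ⟨[], rfl⟩
          uniq := by
            rintro ⟨_ | ⟨b, a⟩, h⟩
            · rfl
            · simp [subAt] at h }
      exact ⟨inferInstance, by simp [atoms]⟩
    · have hc : (var q Y).atoms.count (p, X) = 0 := by
        simpa [atoms, List.count_cons] using h
      rw [hc]
      refine empty fun a => ?_
      cases a <;> simp_all [subAt]
  | tensor q A B ihA ihB =>
    exact sum (leavesEquivSum (by simp [subAt]) (fun _ => rfl) fun _ => rfl) rfl ihA ihB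
  | par q A B ihA ihB =>
    exact sum (leavesEquivSum (by simp [subAt]) (fun _ => rfl) fun _ => rfl) rfl ihA ihB

/-! ### Leaves of a whole net and the balance of its conclusion -/

namespace Net

/-- The leaves of a net labelled with a given signed variable. -/
abbrev Leaves (N : Net) (H : Hypersequent) (p : Polarity) (X : ℕ) : Type :=
  {x : Node // N.label H x = some (.var p X)}

/-- A leaf of a net is a leaf of the conclusion or of one of the two trees of a cut. -/
def leavesEquiv (N : Net) (H : Hypersequent) (p : Polarity) (X : ℕ) :
    N.Leaves H p X ≃ (H.toFormula.polarize .pos).Leaves p X ⊕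
      (Σ i : Fin N.cuts.length, (N.cuts[i].polarize .pos).Leaves p X) ⊕
      (Σ i : Fin N.cuts.length, (N.cuts[i].polarize .neg).Leaves p X) where
  toFun
    | ⟨⟨.main, a⟩, h⟩ => .inl ⟨a, h⟩
    | ⟨⟨.cutPos i, a⟩, h⟩ =>
      have hi : i < N.cuts.length := by
        by_contra hi
        simp [label, tree, List.getElem?_eq_none (not_lt.1 hi)] at h
      .inr (.inl ⟨⟨i, hi⟩, a, by simpa [label, tree, List.getElem?_eq_getElem hi] using h⟩)
    | ⟨⟨.cutNeg i, a⟩, h⟩ =>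
      have hi : i < N.cuts.length := by
        by_contra hi
        simp [label, tree, List.getElem?_eq_none (not_lt.1 hi)] at h
      .inr (.inr ⟨⟨i, hi⟩, a, by simpa [label, tree, List.getElem?_eq_getElem hi] using h⟩)
  invFun
    | .inl a => ⟨⟨.main, a.1⟩, a.2⟩
    | .inr (.inl ⟨i, a⟩) => ⟨⟨.cutPos i, a.1⟩, by simpa [label, tree] using a.2⟩
    | .inr (.inr ⟨i, a⟩) => ⟨⟨.cutNeg i, a.1⟩, by simpa [label, tree] using a.2⟩
  left_inv
    | ⟨⟨.main, _⟩, _⟩ => rfl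
    | ⟨⟨.cutPos _, _⟩, _⟩ => rfl
    | ⟨⟨.cutNeg _, _⟩, _⟩ => rfl
  right_inv
    | .inl _ => rfl
    | .inr (.inl _) => rfl
    | .inr (.inr _) => rfl

theorem card_leaves (N : Net) (H : Hypersequent) (p : Polarity) (X : ℕ) :
    Nat.card (N.Leaves H p X) = (H.toFormula.polarize .pos).atoms.count (p, X) +
      (∑ i : Fin N.cuts.length, (N.cuts[i].polarize .pos).atoms.count (p, X) +
        ∑ i : Fin N.cuts.length, (N.cuts[i].polarize .neg).atoms.count (p, X)) := by
  have fin : ∀ A : PFormula, Finite (A.Leaves p X) := fun A => (A.finite_leaves_and_card p X).1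
  have card : ∀ A : PFormula, Nat.card (A.Leaves p X) = A.atoms.count (p, X) :=
    fun A => (A.finite_leaves_and_card p X).2
  rw [Nat.card_congr (N.leavesEquiv H p X), Nat.card_sum, Nat.card_sum, Nat.card_sigma,
    Nat.card_sigma]
  simp only [card]

/-- The axiom edges of a correct net match the leaves `X⁺` with the leaves `X⁻`. -/
theorem Correct.card_leaves_eq {N : Net} {H : Hypersequent} (h : N.Correct H) (X : ℕ) :
    Nat.card (N.Leaves H .pos X) = Nat.card (N.Leaves H .neg X) := by
  choose f hf hfe using fun x : N.Leaves H .pos X => h.var_pos x.1 X x.2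
  choose g hg hge using fun y : N.Leaves H .neg X => h.var_neg y.1 X y.2
  refine Nat.card_congr ⟨fun x => ⟨f x, hf x⟩, fun y => ⟨g y, hg y⟩, fun x => ?_, fun y => ?_⟩
  · exact Subtype.ext ((hge ⟨f x, hf x⟩ x.1).1 ((hfe x _).2 rfl)).symm
  · exact Subtype.ext ((hfe ⟨g y, hg y⟩ y.1).1 ((hge y _).2 rfl)).symm

theorem Correct.balanced {N : Net} {H : Hypersequent} (h : N.Correct H) :
    Balanced (H.toFormula.polarize .pos).atoms := by
  intro X
  have e := h.card_leaves_eq X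
  rw [card_leaves, card_leaves] at e
  have h₁ := Finset.sum_congr (rfl : (Finset.univ : Finset (Fin N.cuts.length)) = _)
    fun i _ => (N.cuts[i].count_atoms_polarize X).1
  have h₂ := Finset.sum_congr (rfl : (Finset.univ : Finset (Fin N.cuts.length)) = _)
    fun i _ => (N.cuts[i].count_atoms_polarize X).2
  -- By `h₁` and `h₂` the cut sums agree for both signs, with positive and negative trees exchanged,
  -- so they cancel from `e`.
  omega

end Net

end Amida

theorem mainTheorem9 (H : Amida.Hypersequent) (hH : H ≠ [])
    (h : ∃ N : Amida.Net, Amida.IsAmidaNet H N ∧ N.Correct H) :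
    Amida.Derivable H := by
  obtain ⟨N, -, hN⟩ := h
  exact Amida.Derivable.of_balanced hH hN.balanced
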